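/- **Setting.** Let $G=(V,E)$ be a finite connected graph with at least one edge (loops and multiple edges allowed), embedded in the sphere, and let $G^*$ be its dual graph, embedded so that each edge $e$ crosses its dual edge $e^*$ exactly once and there are no other intersections of $G$ and $G^*$. Let $J=(J_e)_{e\in E}$ be positive coupling constants. For complex coupling constants $K=(K_e)_{e\in E}$ the Ising partition function (free boundary conditions) is $$Z_{\rm Ising}(G,K)=\sum_{\sigma\in\{-1,1\}^V}\exp\Bigl(\sum_{e=uv\in E}K_e\sigma_u\sigma_v\Bigr).$$ **Order and disorder.** Let $n,m\ge 0$, let $u_1,\dots,u_{2n}$ be vertices of $G$ and $f_1,\dots,f_{2m}$ vertices of $G^*$ (faces of $G$). For $1\le j\le n$ let $\gamma_j$ be a loop-free path in $G$ from $u_{2j-1}$ to $u_{2j}$, and for $1\le j\le m$ let $\gamma_j^*$ be a loop-free path in $G^*$ from $f_{2j-1}$ to $f_{2j}$. Let $\Gamma\subset E$ be the set of edges of the paths $\gamma_j$, and let $\Gamma^*\subset E$ be the set of edges of $G$ whose dual edges belong to the paths $\gamma_j^*$; suppose that $\Gamma\cap\Gamma^*=\emptyset$. Put $$\bar J_e=J_e+\tfrac{i\pi}{2}\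 \ (e\in\Gamma),\qquad \bar J_e=-J_e\ \ (e\in\Gamma^*),\qquad \bar J_e=J_e\ \ \text{otherwise},$$ and define the Kadanoff–Ceva correlation $$\langle\sigma_{u_1}\cdots\sigma_{u_{2n}}\,\mu_{f_1}\cdots\mu_{f_{2m}}\rangle_{(G,J)}=\frac{Z_{\rm Ising}(G,\bar J)}{Z_{\rm Ising}(G,J)}.$$ **The dimer model.** Superimpose $G$, $G^*$ and the quad-graph (which joins each dual vertex to the primal vertices on the boundary of its face, with one edge for each corner of the face, not crossing $G$ or $G^*$), and add a vertex at each crossing of an edge $e$ with $e^*$. The bipartite graph $G^Q$ is the dual of this embedded graph. It consists of one quadrangle for each edge $e$ of $G$, with two sides parallel to $e$ (they cross the halves of $e^*$) and two sides parallel to $e^*$ (they cross the halves of $e$), and of legs, which join quadrangles and cross the quad-graph edges. For coupling constants $K$ let $\nu(K)$ be the weight function on the edges of $G^Q$ that is $1$ on legs, $\tanh(2K_e)$ on edges parallel to an edge $e$ of $G$, and $1/\cosh(2K_e)$ on edges parallel to a dual edge $e^*$. For a weight function $\nu$ let $Z_{\rm dimer}(G^Q,\nu)=\sum_M\prod_{\mathsf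 e\in M}\nu_{\mathsf e}$, the sum over all perfect matchings $M$ (sets of edges) of $G^Q$. **Theorem 1.** One has $Z_{\rm Ising}(G,J)\ne0$, $Z_{\rm dimer}(G^Q,\nu(J))\neq 0$ and $$\langle\sigma_{u_1}\cdots\sigma_{u_{2n}}\,\mu_{f_1}\cdots\mu_{f_{2m}}\rangle_{(G,J)}^2=(-1)^{|\Gamma|}\,\frac{Z_{\rm dimer}(G^Q,\nu(\bar J))}{Z_{\rm dimer}(G^Q,\nu(J))}.$$ -/

import Mathlib

open scoped BigOperators

/-- A dart of a graph with edge set `E`: an edge together with one of its two orientations. -/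
abbrev Dart (E : Type*) : Type _ := E × Bool

/-- Reversal of orientation, as a permutation of the darts. -/
def Dart.flip (E : Type*) : Equiv.Perm (Dart E) where
  toFun d := (d.1, !d.2)
  invFun d := (d.1, !d.2)
  left_inv d := by simp
  right_inv d := by simp

/-- A graph with vertex set `V` and edge set `E` (loops and multiple edges allowed), drawn on an
oriented surface, in its combinatorial description as a rotation system: every dart has an origin
`tail d`, and `rot d` is the dart that follows `d` in counterclockwise order among the darts
with the same origin. -/
structure EmbeddedGraph (V E : Type*) where
  tail : Dart E → V
  rot : Equiv.Perm (Dart E)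
  sameCycle_rot_iff : ∀ d d' : Dart E, rot.SameCycle d d' ↔ tail d = tail d'

namespace EmbeddedGraph

variable {V E : Type*} (G : EmbeddedGraph V E)

/-- The end point of a dart. -/
def head (d : Dart E) : V := G.tail (Dart.flip E d)

/-- The unordered pair of end points of an edge. -/
def ends (e : E) : Sym2 V := s(G.tail (e, false), G.tail (e, true))

/-- `l` lists the successive darts of a walk from `u` to `v`. -/
def IsWalk : V → V → List (Dart E) → Prop
  | u, v, [] => u = v
  | u, v, d :: l => G.tail d = u ∧ IsWalk (G.head d) v l

/-- A loop-free path from `u` to `v`: a walk that visits no vertex twice. -/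
def IsPath (u v : V) (l : List (Dart E)) : Prop :=
  G.IsWalk u v l ∧ (u :: l.map G.head).Nodup

/-- The next dart on the boundary of the face on the left of a dart: at the end point of `d`, turn
to the dart that precedes the reversal of `d` in counterclockwise order. -/
def facePerm : Equiv.Perm (Dart E) := (Dart.flip E).trans G.rot.symm

/-- The faces, i.e. the cycles of `facePerm`. The class of `d` is the face on the left of `d`. -/
def Face : Type _ := Quotient (Equiv.Perm.SameCycle.setoid G.facePerm)

/-- The face on the left of a dart. -/
def leftFace (d : Dart E) : G.Face := Quotient.mk (Equiv.Perm.SameCycle.setoid G.facePerm) d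

/-- The graph is connected and drawn on the sphere: Euler's formula `|V| - |E| + |F| = 2` says that
the surface of the rotation system has genus `0`. -/
structure IsSpherical : Prop where
  connected : ∀ u v : V, ∃ l : List (Dart E), G.IsWalk u v l
  euler : (Nat.card V : ℤ) - Nat.card E + Nat.card G.Face = 2

/-- The embedded dual graph. Its edges are indexed by the edges of `G`; the dual of the dart `d`
crosses `d` from the face on the left of `d` to the face on the right of `d`. -/
def dual : EmbeddedGraph G.Face E where
  tail := G.leftFace
  rot := G.facePerm
  sameCycle_rot_iff d d' :=
    (Quotient.eq (r := Equiv.Perm.SameCycle.setoid G.facePerm) (x := d) (y := d')).symm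

end EmbeddedGraph

/-- The edges used by a family of paths. -/
noncomputable def pathEdges {E : Type*} {n : ℕ} (γ : Fin n → List (Dart E)) : Finset E :=
  open Classical in Finset.univ.biUnion fun j => ((γ j).map Prod.fst).toFinset

/-! ### The Ising model -/

/-- The Ising partition function of a finite graph with end point map `ends` and (complex) coupling
constants `J`. Spins are elements of `ℤˣ = {1, -1}`. -/
noncomputable def isingZ {V E : Type*} [Fintype V] [Fintype E] (ends : E → Sym2 V)
    (J : E → ℂ) : ℂ :=
  open Classical in
  ∑ σ : V → ℤˣ, Complex.exp (∑ e, J e * ((((ends e).map σ).mul : ℤˣ) : ℤ))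

/-- The modified coupling constants, with order along `Γ` and disorder along `Γd`. -/
noncomputable def modifiedCoupling {E : Type*} (J : E → ℝ) (Γ Γd : Finset E) (e : E) : ℂ :=
  open Classical in
  if e ∈ Γ then (J e : ℂ) + Complex.I * (Real.pi / 2)
  else if e ∈ Γd then -(J e : ℂ)
  else (J e : ℂ)

/-- The order-disorder correlation: the ratio of the modified Ising partition function to the
original one. -/
noncomputable def orderDisorderCorrelation {V E : Type*} [Fintype V] [Fintype E]
    (G : EmbeddedGraph V E) (J : E → ℝ) (Γ Γd : Finset E) : ℂ :=
  isingZ G.ends (modifiedCoupling J Γ Γd) / isingZ G.ends (fun e => (J e : ℂ))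

/-! ### Dimers -/

/-- A dimer configuration (perfect matching): every vertex is incident to exactly one edge
of `M`. -/
def IsDimerConfig {W B : Type*} (ends : B → Sym2 W) (M : Finset B) : Prop :=
  ∀ w : W, ∃! b, b ∈ M ∧ w ∈ ends b

/-- The dimer partition function of a finite graph with end point map `ends` and weights `ν`. -/
noncomputable def dimerZ {W B : Type*} [Fintype B] (ends : B → Sym2 W) (ν : B → ℂ) : ℂ :=
  open Classical in
  ∑ M : Finset B with IsDimerConfig ends M, ∏ b ∈ M, ν b

/-! ### The bipartite graph of quadrangles and legs

Superimpose the graph, its dual graph and the quad-graph (one edge for each corner, from the vertex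
to the face of this corner), with an extra vertex at the crossing of every edge with its dual.
The faces of this superposition are triangles, one on the left and one on the right of the first
half of every dart; its edges are the corners, the halves of the dual edges and the halves of the
edges. The bipartite graph is the dual of the superposition. -/

/-- The triangle on the left, resp. right, of the first half of the dart `d`: its corners are the
origin of `d`, the midpoint of `d`, and the face on the left, resp. right, of `d`. -/
inductive QVertex (E : Type*) : Type _
  | left (d : Dart E)
  | right (d : Dart E)

/-- The edges of the bipartite graph.
* `leg d` crosses the quad-graph edge at the corner between `d` and the next dart `rot d`;
* `parPrimal d` crosses the half, on the left of `d`, of the edge dual to that of `d`: it is the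
  quadrangle edge parallel to the edge of `d`, on the left of `d`;
* `parDual d` crosses the first half of `d`: it is a quadrangle edge parallel to the dual edge. -/
inductive QEdge (E : Type*) : Type _
  | leg (d : Dart E)
  | parPrimal (d : Dart E)
  | parDual (d : Dart E)
  deriving Fintype

/-- The two triangles on both sides of an edge of the superposition. -/
def EmbeddedGraph.qEnds {V E : Type*} (G : EmbeddedGraph V E) : QEdge E → Sym2 (QVertex E)
  | .leg d => s(.left d, .right (G.rot d))
  | .parPrimal d => s(.left d, .right (Dart.flip E d))
  | .parDual d => s(.left d, .right d)

/-- The dimer weights associated with coupling constants `J`. -/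
noncomputable def dimerWeight {E : Type*} (J : E → ℂ) : QEdge E → ℂ
  | .leg _ => 1
  | .parPrimal d => Complex.tanh (2 * J d.1)
  | .parDual d => (Complex.cosh (2 * J d.1))⁻¹

/-! ### Sums over fibres of linear maps with a kernel of order two -/

/-! Everything follows from one identity, `isingZ_sq_eq_dimerZ`: for complex `K` with all `cosh (2 K
e)` nonzero, the squared Ising partition function is `2 ^ |V| * ∏ cosh (2 K e)` times the dimer
partition function. Passing to the modified couplings changes the product of hyperbolic cosines only
by one sign per edge of `Γ`, so dividing two instances gives the theorem. Both sides of the identity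
are sums over pairs (even subgraph `P`, dual even subgraph `Q`) of the same product of
`pairWeight`s. On the Ising side (`isingZ_sq`), two spin configurations differ by a cut, which is
`Q`, and the Fourier expansion over the first one produces `P`. On the dimer side (`dimerZ_qEnds`),
the occupied legs mark corners, and `P`, `Q` record where the marking changes around vertices and
around faces. Cuts cover the `Q` two to one (`range_coboundary`), and admissible markings cover the
pairs two to one (`map_cornerDiff`). Both surjectivities are dimension counts over `ZMod 2`, where
Euler's formula enters. -/

open Classical in
theorem sum_comp_of_ker_eq_pair {A B : Type*} [AddCommGroup A] [AddCommGroup B]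
    [Module (ZMod 2) A] [Module (ZMod 2) B] [Fintype A] [Fintype B]
    (f : A →ₗ[ZMod 2] B) (S : Submodule (ZMod 2) A) (W : Submodule (ZMod 2) B)
    (hSW : S.map f = W) (k : A) (hkS : k ∈ S) (hk0 : k ≠ 0) (hfk : f k = 0)
    (hker : ∀ a ∈ S, f a = 0 → a = 0 ∨ a = k) (w : B → ℂ) :
    ∑ a, (if a ∈ S then w (f a) else 0) = 2 * ∑ b, (if b ∈ W then w b else 0) := by
  rw [← Finset.sum_fiberwise (s := Finset.univ) (g := f), Finset.mul_sum]
  refine Finset.sum_congr rfl fun b _ => ?_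
  rw [← Finset.sum_filter, Finset.filter_filter]
  by_cases hb : b ∈ W
  · rw [← hSW] at hb
    obtain ⟨a, ha, rfl⟩ := hb
    -- A fibre inside `S` is a coset of the kernel `{0, k}`.
    have hfib : (Finset.univ.filter fun a' => f a' = f a ∧ a' ∈ S) = {a, a + k} := by
      ext a'
      simp only [Finset.mem_filter, Finset.mem_univ, true_and, Finset.mem_insert,
        Finset.mem_singleton]
      constructor
      · rintro ⟨h1, h2⟩
        rcases hker (a' - a) (S.sub_mem h2 ha) (by rw [map_sub, h1, sub_self]) with h | h
        · exact Or.inl (sub_eq_zero.mp h)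
        · exact Or.inr (by rw [← h]; abel)
      · rintro (rfl | rfl)
        · exact ⟨rfl, ha⟩
        · exact ⟨by rw [map_add, hfk, add_zero], S.add_mem ha hkS⟩
    have hne : a ≠ a + k := fun h => hk0 (by simpa using h)
    have hW : f a ∈ W := hSW ▸ Submodule.mem_map_of_mem ha
    rw [hfib, Finset.sum_pair hne, map_add, hfk, add_zero, if_pos hW, two_mul]
  · rw [if_neg hb, mul_zero]
    refine Finset.sum_eq_zero fun a ha => ?_
    simp only [Finset.mem_filter, Finset.mem_univ, true_and] at ha
    exact absurd (hSW ▸ ha.1 ▸ Submodule.mem_map_of_mem ha.2) hb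

/-! ### Even subgraphs and cuts, over the field with two elements -/

theorem zmod_two_add_eq_zero {a b : ZMod 2} : a + b = 0 ↔ a = b := by
  revert a b; decide

theorem finrank_le_one_of_const {ι : Type*} [Finite ι] (S : Submodule (ZMod 2) (ι → ZMod 2))
    (h : ∀ τ ∈ S, ∃ c : ZMod 2, τ = fun _ => c) : Module.finrank (ZMod 2) S ≤ 1 := by
  have hle : S ≤ Submodule.span (ZMod 2) {fun _ => 1} := by
    intro τ hτ
    obtain ⟨c, rfl⟩ := h τ hτ
    exact Submodule.mem_span_singleton.mpr ⟨c, by ext; simp⟩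
  refine (Submodule.finrank_mono hle).trans ?_
  simpa using finrank_span_le_card (R := ZMod 2) ({fun _ => 1} : Set (ι → ZMod 2))

theorem finrank_submodule_prod {A B : Type*} [AddCommGroup A] [AddCommGroup B]
    [Module (ZMod 2) A] [Module (ZMod 2) B] [Module.Finite (ZMod 2) A] [Module.Finite (ZMod 2) B]
    (S : Submodule (ZMod 2) A) (T : Submodule (ZMod 2) B) :
    Module.finrank (ZMod 2) (S.prod T) = Module.finrank (ZMod 2) S + Module.finrank (ZMod 2) T := by
  rw [← Module.finrank_prod]
  exact LinearEquiv.finrank_eq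
    { S.toAddSubmonoid.prodEquiv T.toAddSubmonoid with map_smul' := fun _ _ => rfl }

theorem Dart.sum_univ {E M : Type*} [Fintype E] [AddCommMonoid M] (g : Dart E → M) :
    ∑ d, g d = ∑ e, (g (e, false) + g (e, true)) := by
  rw [Fintype.sum_prod_type]
  refine Finset.sum_congr rfl fun e _ => ?_
  rw [Fintype.sum_bool, add_comm]

namespace EmbeddedGraph

variable {V E : Type*} (G : EmbeddedGraph V E)

open Classical in
/-- The incidence matrix modulo two: a loop contributes zero. -/
noncomputable def incMatrix : Matrix V E (ZMod 2) := fun v e =>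
  (if G.tail (e, false) = v then 1 else 0) + (if G.tail (e, true) = v then 1 else 0)

/-- The degrees modulo two of a subgraph. -/
noncomputable def boundary [Fintype E] : (E → ZMod 2) →ₗ[ZMod 2] (V → ZMod 2) :=
  G.incMatrix.mulVecLin

/-- The cut of a two-colouring of the vertices. -/
noncomputable def coboundary [Fintype V] : (V → ZMod 2) →ₗ[ZMod 2] (E → ZMod 2) :=
  G.incMatrix.transpose.mulVecLin

theorem coboundary_apply [Fintype V] (τ : V → ZMod 2) (e : E) :
    G.coboundary τ e = τ (G.tail (e, false)) + τ (G.tail (e, true)) := by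
  classical
  simp [coboundary, Matrix.vecMul, dotProduct, incMatrix, mul_add, Finset.sum_add_distrib]

open Classical in
theorem boundary_apply [Fintype E] (P : E → ZMod 2) (v : V) :
    G.boundary P v = ∑ d : Dart E, if G.tail d = v then P d.1 else 0 := by
  rw [Dart.sum_univ]
  simp [boundary, Matrix.mulVec, dotProduct, incMatrix, add_mul]

theorem sum_boundary_mul [Fintype V] [Fintype E] (P : E → ZMod 2) (τ : V → ZMod 2) :
    ∑ v, G.boundary P v * τ v = ∑ e, P e * G.coboundary τ e := by
  have := Matrix.dotProduct_mulVec P G.incMatrix.transpose τ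
  rw [Matrix.vecMul_transpose] at this
  exact this.symm

/-- `π` permutes the darts at each vertex, so every `x d` enters the degree twice and cancels modulo
two. -/
theorem boundary_eq_zero_of_eq_add_perm [Fintype E] (π : Equiv.Perm (Dart E))
    (hπ : ∀ d, G.tail (π d) = G.tail d) (x : Dart E → ZMod 2) (P : E → ZMod 2)
    (hP : ∀ d, P d.1 = x d + x (π d)) : G.boundary P = 0 := by
  classical
  ext v
  rw [boundary_apply]
  have h : ∑ d : Dart E, (if G.tail d = v then x (π d) else 0)
      = ∑ d : Dart E, (if G.tail d = v then x d else 0) := by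
    rw [← Equiv.sum_comp π fun d => if G.tail d = v then x d else 0]
    simp only [hπ]
  have h2 : ∑ d : Dart E, (if G.tail d = v then P d.1 else 0)
      = ∑ d : Dart E, (if G.tail d = v then x d else 0)
        + ∑ d : Dart E, (if G.tail d = v then x (π d) else 0) := by
    rw [← Finset.sum_add_distrib]
    refine Finset.sum_congr rfl fun d _ => ?_
    split_ifs <;> simp [hP]
  rw [h2, h]
  exact zmod_two_add_eq_zero.mpr rfl

/-- Rank-nullity for the incidence matrix and its transpose, which have equal rank; this rank is at
least `|V| - 1`. -/
theorem finrank_ker_boundary_add [Fintype V] [Fintype E]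
    (hker : ∀ τ : V → ZMod 2, G.coboundary τ = 0 → ∃ c : ZMod 2, τ = fun _ => c) :
    Module.finrank (ZMod 2) (LinearMap.ker G.boundary) + Fintype.card V
      ≤ Fintype.card E + 1 := by
  have h1 := LinearMap.finrank_range_add_finrank_ker G.boundary
  have h2 := LinearMap.finrank_range_add_finrank_ker (G.coboundary)
  have h3 : Module.finrank (ZMod 2) (LinearMap.range G.boundary)
      = Module.finrank (ZMod 2) (LinearMap.range G.coboundary) :=
    (Matrix.rank_transpose G.incMatrix).symm
  have h4 : Module.finrank (ZMod 2) (LinearMap.ker G.coboundary) ≤ 1 :=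
    finrank_le_one_of_const _ hker
  rw [Module.finrank_fintype_fun_eq_card] at h1 h2
  omega

/-! ### Connectedness and functions that it forces to be constant. -/

theorem tail_rot (d : Dart E) : G.tail (G.rot d) = G.tail d :=
  ((G.sameCycle_rot_iff _ _).mp ⟨1, by simp⟩).symm

theorem tail_rot_symm (d : Dart E) : G.tail (G.rot.symm d) = G.tail d := by
  conv_rhs => rw [← G.rot.apply_symm_apply d, tail_rot]

theorem apply_eq_of_tail_eq {α : Type*} [Finite E] (x : Dart E → α)
    (hrot : ∀ d, x (G.rot d) = x d) {d d' : Dart E} (h : G.tail d = G.tail d') : x d = x d' := by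
  obtain ⟨i, -, rfl⟩ := ((G.sameCycle_rot_iff d d').mpr h).exists_pow_eq'
  induction i with
  | zero => rfl
  | succ i ih =>
    rw [pow_succ', Equiv.Perm.mul_apply, hrot]
    exact ih ((G.sameCycle_rot_iff _ _).mp ⟨i, by simp⟩)

instance [Finite E] : Finite G.Face :=
  inferInstanceAs (Finite (Quotient (Equiv.Perm.SameCycle.setoid G.facePerm)))

variable {G}

theorem IsWalk.apply_eq {α : Type*} {τ : V → α} (hτ : ∀ d, τ (G.tail d) = τ (G.head d)) :
    ∀ {l : List (Dart E)} {u v : V}, G.IsWalk u v l → τ u = τ v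
  | [], _, _, h => congrArg τ h
  | d :: _, _, _, h => by
    rw [← h.1, hτ d]
    exact IsWalk.apply_eq hτ h.2

namespace IsSpherical

variable (hG : G.IsSpherical)
include hG

theorem const_of_tail_eq_head {α : Type*} {τ : V → α}
    (hτ : ∀ d, τ (G.tail d) = τ (G.head d)) (u v : V) : τ u = τ v := by
  obtain ⟨l, hl⟩ := hG.connected u v
  exact hl.apply_eq hτ

/-- Faces are cycles of darts, so a graph without edges has no face; being connected, it has at most
one vertex, and Euler's formula would read `2 ≤ 1`. -/
theorem nonempty_edge [Finite V] : Nonempty E := by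
  by_contra hE
  rw [not_nonempty_iff] at hE
  have hs : Subsingleton V := ⟨fun u v => hG.const_of_tail_eq_head (τ := id)
    (fun d => isEmptyElim d.1) u v⟩
  have h1 : Nat.card G.Face = 0 := by
    have : IsEmpty G.Face := ⟨fun f => Quotient.inductionOn f fun d => isEmptyElim d.1⟩
    simp
  have h2 := hG.euler
  have h3 := Finite.card_le_one_iff_subsingleton.mpr hs
  simp [h1] at h2
  omega

theorem exists_tail_eq [Finite V] (v : V) : ∃ d, G.tail d = v := by
  obtain ⟨e⟩ := hG.nonempty_edge
  by_contra! h
  have := hG.const_of_tail_eq_head (τ := fun w => w = v)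
    (fun d => by simp [h d, show G.head d ≠ v from h _]) v (G.tail (e, false))
  simp [h] at this

/-- Invariance under `rot` makes `x` a function of the origin, defined at every vertex by
`exists_tail_eq`; invariance under `flip` carries its value along walks. -/
theorem const_of_rot_of_flip {α : Type*} [Finite V] [Finite E] {x : Dart E → α}
    (hrot : ∀ d, x (G.rot d) = x d) (hflip : ∀ d, x (Dart.flip E d) = x d) (d d' : Dart E) :
    x d = x d' := by
  choose g hg using hG.exists_tail_eq
  have key : ∀ d, x (g (G.tail d)) = x d := fun d => G.apply_eq_of_tail_eq x hrot (hg _)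
  have := hG.const_of_tail_eq_head (τ := fun v => x (g v))
    (fun d => by simp only [head, key, hflip]) (G.tail d) (G.tail d')
  simpa only [key] using this

end IsSpherical

/-! ### The dimension count -/

variable (G)

/-- The number modulo two of marked corners around the midpoint of each edge. -/
def cornerSum : (Dart E → ZMod 2) →ₗ[ZMod 2] (E → ZMod 2) where
  toFun x e := (x (e, false) + x (G.rot.symm (e, false)))
    + (x (e, true) + x (G.rot.symm (e, true)))
  map_add' x y := by ext e; simp only [Pi.add_apply]; ring
  map_smul' c x := by ext e; simp only [Pi.smul_apply, smul_eq_mul, RingHom.id_apply]; ring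

/-- The edges, and the dual edges, across which a marking of the corners changes. -/
def cornerDiff : (Dart E → ZMod 2) →ₗ[ZMod 2] ((E → ZMod 2) × (E → ZMod 2)) where
  toFun x := (fun e => x (e, false) + x (G.rot.symm (e, false)),
    fun e => x (e, false) + x (G.rot.symm (e, true)))
  map_add' x y := by ext e <;> simp only [Pi.add_apply, Prod.fst_add, Prod.snd_add] <;> ring
  map_smul' c x := by
    ext e <;> simp only [Pi.smul_apply, smul_eq_mul, RingHom.id_apply, Prod.smul_fst,
      Prod.smul_snd] <;> ring

variable {G}

/-- An even number of marked corners around a midpoint means that the marking changes across both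
halves of the edge or across neither, so either dart computes the same value. The same holds for the
dual edge. -/
theorem cornerDiff_fst_dart {x : Dart E → ZMod 2} (hx : G.cornerSum x = 0) (d : Dart E) :
    (G.cornerDiff x).1 d.1 = x d + x (G.rot.symm d) := by
  obtain ⟨e, b⟩ := d
  cases b
  · rfl
  · exact zmod_two_add_eq_zero.mp (congrFun hx e)

theorem cornerDiff_snd_dart {x : Dart E → ZMod 2} (hx : G.cornerSum x = 0) (d : Dart E) :
    (G.cornerDiff x).2 d.1 = x d + x (G.facePerm d) := by
  obtain ⟨e, b⟩ := d
  cases b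
  · rfl
  · refine zmod_two_add_eq_zero.mp (Eq.trans ?_ (congrFun hx e))
    change (x (e, false) + x (G.rot.symm (e, true))) + (x (e, true) + x (G.rot.symm (e, false)))
      = (x (e, false) + x (G.rot.symm (e, false))) + (x (e, true) + x (G.rot.symm (e, true)))
    ring

/-- Each corner is counted at two midpoints, so the image lies in the hyperplane of vectors with sum
zero, of dimension `|E| - 1`, while there are `2 |E|` corners. -/
theorem card_le_finrank_ker_cornerSum [Fintype E] (G : EmbeddedGraph V E) [Nonempty E] :
    Fintype.card E + 1 ≤ Module.finrank (ZMod 2) (LinearMap.ker G.cornerSum) := by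
  classical
  have h1 := LinearMap.finrank_range_add_finrank_ker G.cornerSum
  let s : (E → ZMod 2) →ₗ[ZMod 2] ZMod 2 := ∑ e, LinearMap.proj e
  have hs : ∀ y, s y = ∑ e, y e := fun y => by simp [s]
  have hle : LinearMap.range G.cornerSum ≤ LinearMap.ker s := by
    rintro _ ⟨x, rfl⟩
    rw [LinearMap.mem_ker, hs]
    have h2 : ∑ e, G.cornerSum x e = ∑ d : Dart E, (x d + x (G.rot.symm d)) := by
      rw [Dart.sum_univ]; rfl
    rw [h2, Finset.sum_add_distrib, Equiv.sum_comp G.rot.symm x]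
    exact zmod_two_add_eq_zero.mpr rfl
  have h3 := Submodule.finrank_mono hle
  have h4 := LinearMap.finrank_range_add_finrank_ker s
  have h5 : LinearMap.range s = ⊤ := by
    rw [LinearMap.range_eq_top]
    intro c
    obtain ⟨e⟩ := ‹Nonempty E›
    exact ⟨Pi.single e c, by simp [hs]⟩
  rw [h5, finrank_top, Module.finrank_self, Module.finrank_fintype_fun_eq_card] at h4
  rw [Module.finrank_fintype_fun_eq_card, Fintype.card_prod, Fintype.card_bool] at h1
  omega

namespace IsSpherical

variable [Fintype V]

theorem coboundary_eq_zero (hG : G.IsSpherical) {τ : V → ZMod 2} (hτ : G.coboundary τ = 0) (u v : V) : τ u = τ v := by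
  refine hG.const_of_tail_eq_head (fun d => ?_) u v
  have h : ∀ e, τ (G.tail (e, false)) = τ (G.tail (e, true)) := fun e => by
    rw [← zmod_two_add_eq_zero, ← coboundary_apply, hτ]; rfl
  obtain ⟨e, b⟩ := d
  cases b
  · exact h e
  · exact (h e).symm

variable [Fintype E] (hG : G.IsSpherical)
include hG

theorem dual_coboundary_eq_zero [Fintype G.Face] {τ : G.Face → ZMod 2}
    (hτ : G.dual.coboundary τ = 0) (f g : G.Face) : τ f = τ g := by
  have h : ∀ e, τ (G.leftFace (e, false)) = τ (G.leftFace (e, true)) := fun e => by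
    rw [← zmod_two_add_eq_zero]
    exact (coboundary_apply _ _ _).symm.trans (congrFun hτ e)
  have hflip : ∀ d, τ (G.leftFace (Dart.flip E d)) = τ (G.leftFace d) := by
    rintro ⟨e, _ | _⟩
    · exact (h e).symm
    · exact h e
  have hface : ∀ d, G.leftFace (G.facePerm d) = G.leftFace d := G.dual.tail_rot
  -- The reversal of `rot d` is followed by `d` on the boundary of its left face.
  have hrot : ∀ d, τ (G.leftFace (G.rot d)) = τ (G.leftFace d) := fun d => by
    rw [← hflip, ← hface]
    congr 2
    simp [facePerm, Dart.flip]
  induction f using Quotient.inductionOn with | _ d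
  induction g using Quotient.inductionOn with | _ d'
  exact hG.const_of_rot_of_flip (x := fun d => τ (G.leftFace d)) hrot hflip d d'

theorem cornerDiff_eq_zero {x : Dart E → ZMod 2} (hx : G.cornerSum x = 0)
    (hx' : G.cornerDiff x = 0) (d d' : Dart E) : x d = x d' := by
  have h1 : ∀ d, x d = x (G.rot.symm d) := fun d => by
    rw [← zmod_two_add_eq_zero, ← cornerDiff_fst_dart hx, hx']; rfl
  have h2 : ∀ d, x d = x (G.facePerm d) := fun d => by
    rw [← zmod_two_add_eq_zero, ← cornerDiff_snd_dart hx, hx']; rfl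
  refine hG.const_of_rot_of_flip (fun d => ?_) (fun d => ?_) d d'
  · rw [h1, Equiv.symm_apply_apply]
  · rw [h1, h2 d]; rfl

/-- The two bounds are `|E| - |V| + 1` and `|E| - |F| + 1`; Euler's formula turns their sum into
`|E|` and the second into `|V| - 1`. -/
theorem finrank_cycles_le [Fintype G.Face] :
    Module.finrank (ZMod 2) (LinearMap.ker G.boundary)
      + Module.finrank (ZMod 2) (LinearMap.ker G.dual.boundary) ≤ Fintype.card E ∧
    Module.finrank (ZMod 2) (LinearMap.ker G.dual.boundary) + 1 ≤ Fintype.card V := by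
  obtain ⟨e⟩ := hG.nonempty_edge
  have h1 := G.finrank_ker_boundary_add fun τ hτ =>
    ⟨τ (G.tail (e, false)), funext fun v => hG.coboundary_eq_zero hτ _ _⟩
  have h2 := G.dual.finrank_ker_boundary_add fun τ hτ =>
    ⟨τ (G.leftFace (e, false)), funext fun v => hG.dual_coboundary_eq_zero hτ _ _⟩
  have h3 := hG.euler
  rw [Nat.card_eq_fintype_card, Nat.card_eq_fintype_card, Nat.card_eq_fintype_card] at h3
  omega

/-- Around a face the colour changes an even number of times. Conversely, the cuts have dimension at
least `|V| - 1`, which bounds that of the dual even subgraphs. -/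
theorem range_coboundary [Fintype G.Face] :
    LinearMap.range G.coboundary = LinearMap.ker G.dual.boundary := by
  refine Submodule.eq_of_le_of_finrank_le ?_ ?_
  · rintro _ ⟨τ, rfl⟩
    refine G.dual.boundary_eq_zero_of_eq_add_perm G.facePerm G.dual.tail_rot
      (fun d => τ (G.tail d)) _ fun d => ?_
    have h : G.tail (G.facePerm d) = G.head d := G.tail_rot_symm _
    rw [coboundary_apply, h]
    obtain ⟨e, _ | _⟩ := d
    · rfl
    · exact add_comm _ _
  · have h := hG.finrank_cycles_le.2
    have h2 := LinearMap.finrank_range_add_finrank_ker G.coboundary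
    obtain ⟨e⟩ := hG.nonempty_edge
    have h3 : Module.finrank (ZMod 2) (LinearMap.ker G.coboundary) ≤ 1 :=
      finrank_le_one_of_const _ fun τ hτ =>
        ⟨τ (G.tail (e, false)), funext fun v => hG.coboundary_eq_zero hτ _ _⟩
    rw [Module.finrank_fintype_fun_eq_card] at h2
    omega

/-- Changes around a vertex or a face are even in number. Equality holds because the image has
dimension at least `(|E| + 1) - 1`, the kernel consisting of constant markings, and the target has
dimension at most `|E|`. -/
theorem map_cornerDiff [Fintype G.Face] :
    (LinearMap.ker G.cornerSum).map G.cornerDiff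
      = (LinearMap.ker G.boundary).prod (LinearMap.ker G.dual.boundary) := by
  refine Submodule.eq_of_le_of_finrank_le ?_ ?_
  · rintro _ ⟨x, hx, rfl⟩
    refine ⟨?_, ?_⟩
    · refine G.boundary_eq_zero_of_eq_add_perm G.rot.symm G.tail_rot_symm x _ fun d => ?_
      exact cornerDiff_fst_dart hx d
    · refine G.dual.boundary_eq_zero_of_eq_add_perm G.facePerm G.dual.tail_rot x _ fun d => ?_
      exact cornerDiff_snd_dart hx d
  · have h := hG.finrank_cycles_le.1
    have hE := hG.nonempty_edge
    have h1 := G.card_le_finrank_ker_cornerSum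
    have h2 := LinearMap.finrank_range_add_finrank_ker
      (G.cornerDiff.domRestrict (LinearMap.ker G.cornerSum))
    rw [LinearMap.range_domRestrict] at h2
    have h3 : Module.finrank (ZMod 2)
        (LinearMap.ker (G.cornerDiff.domRestrict (LinearMap.ker G.cornerSum))) ≤ 1 := by
      rw [← Submodule.finrank_map_subtype_eq]
      refine finrank_le_one_of_const _ ?_
      rintro _ ⟨⟨x, hx⟩, hx', rfl⟩
      obtain ⟨e⟩ := hE
      exact ⟨x (e, false), funext fun d => hG.cornerDiff_eq_zero hx hx' _ _⟩
    rw [finrank_submodule_prod]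
    omega

end IsSpherical
end EmbeddedGraph

/-! ### The square of the Ising partition function -/

/-- The local weight of the pair of an even subgraph and a dual even subgraph, given their values
`p` and `q` at an edge with coupling constant `K`. -/
noncomputable def pairWeight (K : ℂ) (p q : ZMod 2) : ℂ :=
  if p = 0 then (if q = 0 then 1 else (Complex.cosh (2 * K))⁻¹)
  else (if q = 0 then Complex.tanh (2 * K) else 0)

/-- The nontrivial character of the group of order two. -/
def zmodSign (a : ZMod 2) : ℂ := if a = 0 then 1 else -1

theorem zmod_two_cases (a : ZMod 2) : a = 0 ∨ a = 1 := by
  revert a; decide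

theorem zmodSign_add (a b : ZMod 2) : zmodSign (a + b) = zmodSign a * zmodSign b := by
  rcases zmod_two_cases a with rfl | rfl <;> rcases zmod_two_cases b with rfl | rfl <;>
    simp [zmodSign, show (1 + 1 : ZMod 2) = 0 from rfl]

theorem zmodSign_sum {ι : Type*} (s : Finset ι) (a : ι → ZMod 2) :
    zmodSign (∑ i ∈ s, a i) = ∏ i ∈ s, zmodSign (a i) := by
  classical
  induction s using Finset.induction_on with
  | empty => simp [zmodSign]
  | insert i s hi ih => rw [Finset.sum_insert hi, Finset.prod_insert hi, zmodSign_add, ih]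

theorem sum_zmod_two {M : Type*} [AddCommMonoid M] (g : ZMod 2 → M) : ∑ a, g a = g 0 + g 1 :=
  Fin.sum_univ_two g

/-- Fourier expansion in `a`: equal signs (`b = 0`) give `exp (±2K) = cosh (2K) ± sinh (2K)`,
opposite signs give `1`. -/
theorem exp_mul_exp_zmodSign {K : ℂ} (hK : Complex.cosh (2 * K) ≠ 0) (a b : ZMod 2) :
    Complex.exp (K * zmodSign a) * Complex.exp (K * zmodSign (a + b))
      = Complex.cosh (2 * K) * ∑ p, pairWeight K p b * zmodSign (p * a) := by
  have h1 : Complex.exp (2 * K) = Complex.cosh (2 * K) + Complex.sinh (2 * K) :=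
    (Complex.cosh_add_sinh _).symm
  have h2 : Complex.exp (-(2 * K)) = Complex.cosh (2 * K) - Complex.sinh (2 * K) :=
    (Complex.cosh_sub_sinh _).symm
  have h3 : Complex.cosh (2 * K) * Complex.tanh (2 * K) = Complex.sinh (2 * K) := by
    rw [Complex.tanh_eq_sinh_div_cosh, mul_div_cancel₀ _ hK]
  rw [← Complex.exp_add, sum_zmod_two]
  rcases zmod_two_cases a with rfl | rfl <;> rcases zmod_two_cases b with rfl | rfl <;>
    simp [zmodSign, pairWeight, show (1 + 1 : ZMod 2) = 0 from rfl, mul_add, h3, hK]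
  · rw [two_mul]
  · rw [← sub_eq_add_neg _ (Complex.sinh _), ← h2]; congr 1; ring

open Classical in
-- Orthogonality of characters; applied to `y = boundary P`, it keeps only the even subgraphs.
theorem sum_zmodSign_dotProduct {V : Type*} [Fintype V] (y : V → ZMod 2) :
    ∑ s : V → ZMod 2, zmodSign (∑ v, y v * s v) = if y = 0 then 2 ^ Fintype.card V else 0 := by
  simp only [zmodSign_sum]
  rw [← Fintype.prod_sum fun v a => zmodSign (y v * a)]
  have h : ∀ v, ∑ a, zmodSign (y v * a) = if y v = 0 then 2 else 0 := fun v => by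
    rw [sum_zmod_two]
    rcases zmod_two_cases (y v) with h | h <;> simp [h, zmodSign]
    norm_num
  simp only [h]
  split_ifs with hy
  · simp [hy]
  · obtain ⟨v, hv⟩ := Function.ne_iff.mp hy
    exact Finset.prod_eq_zero (Finset.mem_univ v) (if_neg hv)

/-- The additive group of order two, as the group of signs. -/
noncomputable def zmodTwoEquivUnits : ZMod 2 ≃ ℤˣ :=
  Equiv.ofBijective (fun a => if a = 0 then 1 else -1) (by decide)

namespace EmbeddedGraph

variable {V E : Type*} [Fintype V] [Fintype E] (G : EmbeddedGraph V E)

open Classical in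
theorem isingZ_eq_sum (K : E → ℂ) :
    isingZ G.ends K = ∑ s : V → ZMod 2, ∏ e, Complex.exp (K e * zmodSign (G.coboundary s e)) := by
  unfold isingZ
  rw [← Equiv.sum_comp (Equiv.arrowCongr (Equiv.refl V) zmodTwoEquivUnits)]
  refine Finset.sum_congr rfl fun s _ => ?_
  rw [Complex.exp_sum]
  refine Finset.prod_congr rfl fun e _ => ?_
  congr 2
  have h : ∀ a, (((zmodTwoEquivUnits a : ℤˣ) : ℤ) : ℂ) = zmodSign a := fun a => by
    rcases zmod_two_cases a with rfl | rfl <;> simp [zmodTwoEquivUnits, zmodSign]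
  rw [coboundary_apply, zmodSign_add, ← h, ← h]
  simp [ends]

open Classical in
theorem isingZ_sq (K : E → ℂ) (hK : ∀ e, Complex.cosh (2 * K e) ≠ 0) :
    isingZ G.ends K ^ 2 = 2 ^ Fintype.card V * (∏ e, Complex.cosh (2 * K e)) *
      ∑ P : E → ZMod 2, if P ∈ LinearMap.ker G.boundary then
        ∑ τ : V → ZMod 2, ∏ e, pairWeight (K e) (P e) (G.coboundary τ e) else 0 := by
  have h1 : isingZ G.ends K ^ 2 = ∑ s : V → ZMod 2, ∑ τ : V → ZMod 2,
      ∏ e, (Complex.cosh (2 * K e) * ∑ p, pairWeight (K e) p (G.coboundary τ e) *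
        zmodSign (p * G.coboundary s e)) := by
    rw [isingZ_eq_sum, sq, Finset.sum_mul_sum]
    refine Finset.sum_congr rfl fun s _ => ?_
    -- The second spin configuration is written as `s + τ`.
    rw [← Equiv.sum_comp (Equiv.addLeft s)]
    refine Finset.sum_congr rfl fun τ _ => ?_
    rw [← Finset.prod_mul_distrib]
    refine Finset.prod_congr rfl fun e _ => ?_
    rw [Equiv.coe_addLeft, map_add, Pi.add_apply, exp_mul_exp_zmodSign (hK e)]
  have h2 : ∀ s τ : V → ZMod 2,
      ∏ e, (Complex.cosh (2 * K e) * ∑ p, pairWeight (K e) p (G.coboundary τ e) *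
        zmodSign (p * G.coboundary s e))
      = (∏ e, Complex.cosh (2 * K e)) * ∑ P : E → ZMod 2,
        (∏ e, pairWeight (K e) (P e) (G.coboundary τ e)) *
          zmodSign (∑ v, G.boundary P v * s v) := fun s τ => by
    rw [Finset.prod_mul_distrib, Fintype.prod_sum]
    congr 1
    refine Finset.sum_congr rfl fun P _ => ?_
    rw [Finset.prod_mul_distrib, sum_boundary_mul, zmodSign_sum]
  rw [h1]
  simp only [h2, ← Finset.mul_sum]
  rw [mul_comm (2 ^ _), mul_assoc]
  congr 1
  rw [Finset.sum_comm]
  simp only [Finset.sum_comm (s := Finset.univ (α := V → ZMod 2)) (t := Finset.univ (α := E → ZMod 2)),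
    ← Finset.mul_sum, sum_zmodSign_dotProduct]
  rw [Finset.mul_sum]
  refine Finset.sum_congr rfl fun P _ => ?_
  rw [← Finset.sum_mul, LinearMap.mem_ker]
  split_ifs
  · ring
  · simp

end EmbeddedGraph

/-! ### The dimer partition function -/

/-- Exactly one of three elements of the field with two elements is one. -/
def ExactlyOne (a b c : ZMod 2) : Prop :=
  (a = 1 ∧ b = 0 ∧ c = 0) ∨ (a = 0 ∧ b = 1 ∧ c = 0) ∨ (a = 0 ∧ b = 0 ∧ c = 1)

instance (a b c : ZMod 2) : Decidable (ExactlyOne a b c) := by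
  unfold ExactlyOne; infer_instance

/-- Used at the vertices of the bipartite graph, which have degree three. -/
theorem existsUnique_iff_exactlyOne {B : Type*} (b : B → ZMod 2) (S : B → Prop) {b₁ b₂ b₃ : B}
    (h12 : b₁ ≠ b₂) (h13 : b₁ ≠ b₃) (h23 : b₂ ≠ b₃) (hS : ∀ c, S c ↔ c = b₁ ∨ c = b₂ ∨ c = b₃) :
    (∃! c, b c = 1 ∧ S c) ↔ ExactlyOne (b b₁) (b b₂) (b b₃) := by
  have h01 : (0 : ZMod 2) ≠ 1 := by decide
  constructor
  · rintro ⟨c, ⟨hc, hcS⟩, hu⟩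
    have hz : ∀ c', S c' → c' ≠ c → b c' = 0 := fun c' h hne =>
      (zmod_two_cases (b c')).resolve_right fun h1 => hne (hu c' ⟨h1, h⟩)
    have hS1 := (hS b₁).mpr (by simp)
    have hS2 := (hS b₂).mpr (by simp)
    have hS3 := (hS b₃).mpr (by simp)
    rcases (hS c).mp hcS with rfl | rfl | rfl
    · exact Or.inl ⟨hc, hz _ hS2 h12.symm, hz _ hS3 h13.symm⟩
    · exact Or.inr (Or.inl ⟨hz _ hS1 h12, hc, hz _ hS3 h23.symm⟩)
    · exact Or.inr (Or.inr ⟨hz _ hS1 h13, hz _ hS2 h23, hc⟩)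
  · rintro (⟨h1, h2, h3⟩ | ⟨h1, h2, h3⟩ | ⟨h1, h2, h3⟩)
    · refine ⟨b₁, ⟨h1, (hS _).mpr (by simp)⟩, ?_⟩
      rintro c ⟨hc, hcS⟩
      rcases (hS c).mp hcS with rfl | rfl | rfl <;> simp_all
    · refine ⟨b₂, ⟨h2, (hS _).mpr (by simp)⟩, ?_⟩
      rintro c ⟨hc, hcS⟩
      rcases (hS c).mp hcS with rfl | rfl | rfl <;> simp_all
    · refine ⟨b₃, ⟨h3, (hS _).mpr (by simp)⟩, ?_⟩
      rintro c ⟨hc, hcS⟩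
      rcases (hS c).mp hcS with rfl | rfl | rfl <;> simp_all

/-- The edges of the bipartite graph, sorted into legs and quadrangles; the sides of the quadrangle
of an edge are those parallel to it and those parallel to its dual. -/
def QEdge.equivSum (E : Type*) : QEdge E ≃ Dart E ⊕ (E × (Bool ⊕ Bool)) where
  toFun
    | .leg d => .inl d
    | .parPrimal d => .inr (d.1, .inl d.2)
    | .parDual d => .inr (d.1, .inr d.2)
  invFun
    | .inl d => .leg d
    | .inr (e, .inl b) => .parPrimal (e, b)
    | .inr (e, .inr b) => .parDual (e, b)
  left_inv := by rintro (d | d | d) <;> rfl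
  right_inv := by rintro (d | ⟨e, b | b⟩) <;> rfl

/-- Sets of edges of the bipartite graph, as sets of legs together with a set of sides of each
quadrangle. -/
def QEdge.functionEquiv (E R : Type*) :
    (QEdge E → R) ≃ (Dart E → R) × (E → (R × R) × (R × R)) where
  toFun b := (fun d => b (.leg d), fun e =>
    ((b (.parPrimal (e, false)), b (.parPrimal (e, true))),
      (b (.parDual (e, false)), b (.parDual (e, true)))))
  invFun y
    | .leg d => y.1 d
    | .parPrimal (e, false) => (y.2 e).1.1
    | .parPrimal (e, true) => (y.2 e).1.2
    | .parDual (e, false) => (y.2 e).2.1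
    | .parDual (e, true) => (y.2 e).2.2
  left_inv b := by
    ext c
    rcases c with d | ⟨e, _ | _⟩ | ⟨e, _ | _⟩ <;> rfl
  right_inv y := rfl

theorem QEdge.prod_univ {E M : Type*} [Fintype E] [CommMonoid M] (g : QEdge E → M) :
    ∏ c, g c = (∏ d, g (.leg d)) * ∏ e, ((g (.parPrimal (e, false)) * g (.parPrimal (e, true))) *
      (g (.parDual (e, false)) * g (.parDual (e, true)))) := by
  have h : ∏ c, g c = ∏ c, g ((QEdge.equivSum E).symm c) := (Equiv.prod_comp _ g).symm
  rw [h, Fintype.prod_sum_type]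
  refine congrArg₂ (· * ·) rfl ((Fintype.prod_prod_type _).trans <| Finset.prod_congr rfl fun e _ => ?_)
  have hb : ∀ φ : Bool → M, ∏ b, φ b = φ false * φ true := fun φ => by
    rw [Fintype.prod_bool, mul_comm]
  rw [Fintype.prod_sum_type, hb, hb]
  rfl

/-- The factor of a member of a set of edges. -/
noncomputable def memWeight (ν : ℂ) (a : ZMod 2) : ℂ := if a = 1 then ν else 1

/-- The matching condition at the four vertices of a quadrangle. The legs at the left and right
triangles of its two darts are `l₁`, `r₁`, `l₂`, `r₂`. -/
def QuadMatching (l₁ r₁ l₂ r₂ : ZMod 2) (y : (ZMod 2 × ZMod 2) × (ZMod 2 × ZMod 2)) : Prop :=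
  (ExactlyOne l₁ y.1.1 y.2.1 ∧ ExactlyOne r₁ y.1.2 y.2.1) ∧
    (ExactlyOne l₂ y.1.2 y.2.2 ∧ ExactlyOne r₂ y.1.1 y.2.2)

instance (l₁ r₁ l₂ r₂ y) : Decidable (QuadMatching l₁ r₁ l₂ r₂ y) := by
  unfold QuadMatching; infer_instance

/-- The sides must match the vertices whose legs are unoccupied: impossible for an odd number or for
two opposite ones, and a single side for two adjacent ones. -/
theorem sum_quadMatching {K : ℂ} (hK : Complex.cosh (2 * K) ≠ 0) (l₁ r₁ l₂ r₂ : ZMod 2) :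
    ∑ y, (if QuadMatching l₁ r₁ l₂ r₂ y then
      (memWeight (Complex.tanh (2 * K)) y.1.1 * memWeight (Complex.tanh (2 * K)) y.1.2) *
        (memWeight (Complex.cosh (2 * K))⁻¹ y.2.1 * memWeight (Complex.cosh (2 * K))⁻¹ y.2.2)
      else 0)
    = if (l₁ + r₁) + (l₂ + r₂) = 0 then pairWeight K (l₁ + r₁) (l₁ + r₂) else 0 := by
  have key : Complex.tanh (2 * K) * Complex.tanh (2 * K)
      + (Complex.cosh (2 * K))⁻¹ * (Complex.cosh (2 * K))⁻¹ = 1 := by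
    rw [Complex.tanh_eq_sinh_div_cosh]
    field_simp
    linear_combination -(Complex.cosh_sq (2 * K))
  simp only [Fintype.sum_prod_type, sum_zmod_two]
  rcases zmod_two_cases l₁ with rfl | rfl <;> rcases zmod_two_cases r₁ with rfl | rfl <;>
    rcases zmod_two_cases l₂ with rfl | rfl <;> rcases zmod_two_cases r₂ with rfl | rfl <;>
    simp [QuadMatching, ExactlyOne, memWeight, pairWeight, show (1 + 1 : ZMod 2) = 0 from rfl]
  -- Without occupied legs there are two matchings, by opposite sides, of total weight `tanh² +
  -- cosh⁻² = 1`.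
  all_goals linear_combination key

open Classical in
theorem dimerZ_eq_sum {W B : Type*} [Fintype B] (ends : B → Sym2 W) (ν : B → ℂ) :
    dimerZ ends ν = ∑ b : B → ZMod 2, if ∀ w, ∃! c, b c = 1 ∧ w ∈ ends c then
      ∏ c, memWeight (ν c) (b c) else 0 := by
  unfold dimerZ
  rw [Finset.sum_filter]
  symm
  refine Fintype.sum_bijective (fun b => Finset.univ.filter fun c => b c = 1) ?_ _ _ fun b => ?_
  · refine Function.bijective_iff_has_inverse.mpr ⟨fun M c => if c ∈ M then 1 else 0, ?_, ?_⟩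
    · intro b
      ext c
      rcases zmod_two_cases (b c) with h | h <;> simp [h]
    · intro M
      ext c
      simp
  · simp [IsDimerConfig, memWeight, Finset.prod_filter]

namespace EmbeddedGraph

variable {V E : Type*} (G : EmbeddedGraph V E)

theorem forall_existsUnique_qEnds_iff (b : QEdge E → ZMod 2) :
    (∀ w, ∃! c, b c = 1 ∧ w ∈ G.qEnds c) ↔
      ∀ e, QuadMatching (b (.leg (e, false))) (b (.leg (G.rot.symm (e, false))))
        (b (.leg (e, true))) (b (.leg (G.rot.symm (e, true))))
        ((b (.parPrimal (e, false)), b (.parPrimal (e, true))),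
          (b (.parDual (e, false)), b (.parDual (e, true)))) := by
  have hl : ∀ d, (∃! c, b c = 1 ∧ QVertex.left d ∈ G.qEnds c) ↔
      ExactlyOne (b (.leg d)) (b (.parPrimal d)) (b (.parDual d)) := fun d => by
    refine existsUnique_iff_exactlyOne b _ (by simp) (by simp) (by simp) fun c => ?_
    rcases c with d' | d' | d' <;> simp [qEnds, eq_comm]
  have hr : ∀ d, (∃! c, b c = 1 ∧ QVertex.right d ∈ G.qEnds c) ↔
      ExactlyOne (b (.leg (G.rot.symm d))) (b (.parPrimal (Dart.flip E d))) (b (.parDual d)) :=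
    fun d => by
    refine existsUnique_iff_exactlyOne b _ (by simp) (by simp) (by simp) fun c => ?_
    rcases c with d' | d' | d'
    · simp [qEnds, Equiv.eq_symm_apply, eq_comm]
    · have h : d = Dart.flip E d' ↔ d' = Dart.flip E d := by
        constructor <;> rintro rfl <;> simp [Dart.flip]
      simp [qEnds, h]
    · simp [qEnds, eq_comm]
  constructor
  · intro h e
    exact ⟨⟨(hl _).mp (h _), (hr (e, false)).mp (h _)⟩, (hl _).mp (h _), (hr (e, true)).mp (h _)⟩
  · rintro h (⟨e, _ | _⟩ | ⟨e, _ | _⟩)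
    · exact (hl _).mpr (h e).1.1
    · exact (hl _).mpr (h e).2.1
    · exact (hr (e, false)).mpr (h e).1.2
    · exact (hr (e, true)).mpr (h e).2.2

-- Once the legs, of weight one, are fixed, the quadrangles are independent and the sum over their
-- sides factorizes.
open Classical in
theorem dimerZ_qEnds [Fintype E] (K : E → ℂ) (hK : ∀ e, Complex.cosh (2 * K e) ≠ 0) :
    dimerZ G.qEnds (dimerWeight K) = ∑ x : Dart E → ZMod 2, if x ∈ LinearMap.ker G.cornerSum then
      ∏ e, pairWeight (K e) ((G.cornerDiff x).1 e) ((G.cornerDiff x).2 e) else 0 := by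
  rw [dimerZ_eq_sum, ← Equiv.sum_comp (QEdge.functionEquiv E (ZMod 2)).symm,
    Fintype.sum_prod_type]
  refine Finset.sum_congr rfl fun x _ => ?_
  have h1 : ∀ y, (if ∀ w, ∃! c, (QEdge.functionEquiv E (ZMod 2)).symm (x, y) c = 1 ∧
        w ∈ G.qEnds c then
        ∏ c, memWeight (dimerWeight K c) ((QEdge.functionEquiv E (ZMod 2)).symm (x, y) c) else 0)
      = ∏ e, if QuadMatching (x (e, false)) (x (G.rot.symm (e, false)))
          (x (e, true)) (x (G.rot.symm (e, true))) (y e) then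
        (memWeight (Complex.tanh (2 * K e)) (y e).1.1 *
          memWeight (Complex.tanh (2 * K e)) (y e).1.2) *
        (memWeight (Complex.cosh (2 * K e))⁻¹ (y e).2.1 *
          memWeight (Complex.cosh (2 * K e))⁻¹ (y e).2.2) else 0 := fun y => by
    rw [Finset.prod_ite_zero, QEdge.prod_univ,
      Finset.prod_eq_one fun d _ => by simp [memWeight, dimerWeight], one_mul]
    simp only [forall_existsUnique_qEnds_iff, Finset.mem_univ, true_imp_iff]
    rfl
  simp only [h1]
  rw [← Fintype.prod_sum fun e y => if QuadMatching (x (e, false)) (x (G.rot.symm (e, false)))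
          (x (e, true)) (x (G.rot.symm (e, true))) y then
        (memWeight (Complex.tanh (2 * K e)) y.1.1 * memWeight (Complex.tanh (2 * K e)) y.1.2) *
        (memWeight (Complex.cosh (2 * K e))⁻¹ y.2.1 *
          memWeight (Complex.cosh (2 * K e))⁻¹ y.2.2) else 0]
  simp only [sum_quadMatching (hK _)]
  rw [Finset.prod_ite_zero]
  simp only [LinearMap.mem_ker, funext_iff, Finset.mem_univ, true_imp_iff]
  rfl

end EmbeddedGraph

/-! ### The bosonization identity -/

open Classical in
theorem EmbeddedGraph.IsSpherical.isingZ_sq_eq_dimerZ {V E : Type*} [Fintype V] [Fintype E]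
    {G : EmbeddedGraph V E} (hG : G.IsSpherical) (K : E → ℂ)
    (hK : ∀ e, Complex.cosh (2 * K e) ≠ 0) :
    isingZ G.ends K ^ 2 = 2 ^ Fintype.card V * (∏ e, Complex.cosh (2 * K e)) *
      dimerZ G.qEnds (dimerWeight K) := by
  have := Fintype.ofFinite G.Face
  obtain ⟨e₀⟩ := hG.nonempty_edge
  have hne : (1 : ZMod 2) ≠ 0 := by decide
  rw [G.isingZ_sq K hK, G.dimerZ_qEnds K hK]
  congr 1
  -- The kernel vector `1` marks all corners. The resulting factor two balances the one from the
  -- cuts below, where `1` is the constant colouring.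
  rw [sum_comp_of_ker_eq_pair G.cornerDiff _ _ hG.map_cornerDiff 1 ?_ ?_ ?_ ?_
    fun b => ∏ e, pairWeight (K e) (b.1 e) (b.2 e)]
  rotate_left
  · ext e
    simp [EmbeddedGraph.cornerSum, show (1 + 1 : ZMod 2) = 0 from rfl]
  · exact fun h => hne (congrFun h (e₀, false))
  · ext e <;> simp [EmbeddedGraph.cornerDiff, show (1 + 1 : ZMod 2) = 0 from rfl]
  · intro x hx hx'
    have h : ∀ d, x d = x (e₀, false) := fun d => hG.cornerDiff_eq_zero hx hx' _ _
    rcases zmod_two_cases (x (e₀, false)) with h0 | h0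
    · exact Or.inl (funext fun d => (h d).trans h0)
    · exact Or.inr (funext fun d => (h d).trans h0)
  rw [Fintype.sum_prod_type, Finset.mul_sum]
  refine Finset.sum_congr rfl fun P _ => ?_
  have h := sum_comp_of_ker_eq_pair G.coboundary ⊤ (LinearMap.ker G.dual.boundary)
    (by rw [Submodule.map_top, hG.range_coboundary]) 1 trivial
    (fun h => hne (congrFun h (G.tail (e₀, false))))
    (by ext e; simp [EmbeddedGraph.coboundary_apply, show (1 + 1 : ZMod 2) = 0 from rfl])
    (fun τ _ hτ => by
      have h : ∀ v, τ v = τ (G.tail (e₀, false)) := fun v => hG.coboundary_eq_zero hτ _ _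
      rcases zmod_two_cases (τ (G.tail (e₀, false))) with h0 | h0
      · exact Or.inl (funext fun v => (h v).trans h0)
      · exact Or.inr (funext fun v => (h v).trans h0))
    (fun Q => ∏ e, pairWeight (K e) (P e) (Q e))
  simp only [Submodule.mem_top, if_true] at h
  by_cases hP : P ∈ LinearMap.ker G.boundary
  · simp only [hP, if_true, Submodule.mem_prod, true_and]
    exact h
  · simp [hP, Submodule.mem_prod, -LinearMap.mem_ker]

/-! ### Nonvanishing, and the effect of order and disorder. -/

theorem isingZ_ne_zero {V E : Type*} [Fintype V] [Fintype E] (ends : E → Sym2 V) (J : E → ℝ) :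
    isingZ ends (fun e => (J e : ℂ)) ≠ 0 := by
  classical
  have h : isingZ ends (fun e => (J e : ℂ)) = ((∑ σ : V → ℤˣ,
      Real.exp (∑ e, J e * ((((ends e).map σ).mul : ℤˣ) : ℤ)) : ℝ) : ℂ) := by
    unfold isingZ
    push_cast
    congr!
  rw [h, Complex.ofReal_ne_zero]
  exact (Finset.sum_pos (fun _ _ => Real.exp_pos _) Finset.univ_nonempty).ne'

theorem cosh_two_mul_ofReal_ne_zero (x : ℝ) : Complex.cosh (2 * (x : ℂ)) ≠ 0 := by
  rw [show 2 * (x : ℂ) = ((2 * x : ℝ) : ℂ) by push_cast; rfl, ← Complex.ofReal_cosh,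
    Complex.ofReal_ne_zero]
  exact (Real.cosh_pos _).ne'

-- Order shifts `2 J e` by `iπ`, which negates `cosh`; disorder changes the sign of `2 J e`, and
-- `cosh` is even.
open Classical in
theorem cosh_two_mul_modifiedCoupling {E : Type*} (J : E → ℝ) (Γ Γd : Finset E) (e : E) :
    Complex.cosh (2 * modifiedCoupling J Γ Γd e)
      = (if e ∈ Γ then -1 else 1) * Complex.cosh (2 * (J e : ℂ)) := by
  unfold modifiedCoupling
  split_ifs
  · rw [show 2 * ((J e : ℂ) + Complex.I * (Real.pi / 2)) = 2 * J e + Real.pi * Complex.I by ring,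
      Complex.cosh_add, Complex.cosh_mul_I, Complex.sinh_mul_I]
    simp
  · rw [mul_neg, Complex.cosh_neg, one_mul]
  · rw [one_mul]

theorem prod_cosh_two_mul_modifiedCoupling {E : Type*} [Fintype E] (J : E → ℝ) (Γ Γd : Finset E) :
    ∏ e, Complex.cosh (2 * modifiedCoupling J Γ Γd e)
      = (-1) ^ Γ.card * ∏ e, Complex.cosh (2 * (J e : ℂ)) := by
  classical
  simp only [cosh_two_mul_modifiedCoupling, Finset.prod_mul_distrib]
  congr 1
  rw [Finset.prod_ite_mem, Finset.univ_inter, Finset.prod_const]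

theorem theorem1 {V E : Type*} [Fintype V] [Fintype E]
    (G : EmbeddedGraph V E) (hG : G.IsSpherical)
    (J : E → ℝ) (hJ : ∀ e, 0 < J e)
    (n m : ℕ) (u : Fin (2 * n) → V) (f : Fin (2 * m) → G.Face)
    (γ : Fin n → List (Dart E)) (γd : Fin m → List (Dart E))
    (hγ : ∀ j : Fin n,
      G.IsPath (u ⟨2 * j, by omega⟩) (u ⟨2 * j + 1, by omega⟩) (γ j))
    (hγd : ∀ j : Fin m,
      G.dual.IsPath (f ⟨2 * j, by omega⟩) (f ⟨2 * j + 1, by omega⟩) (γd j))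
    (hdisj : Disjoint (pathEdges γ) (pathEdges γd)) :
    isingZ G.ends (fun e => (J e : ℂ)) ≠ 0 ∧
    dimerZ G.qEnds (dimerWeight fun e => (J e : ℂ)) ≠ 0 ∧
    orderDisorderCorrelation G J (pathEdges γ) (pathEdges γd) ^ 2 =
      (-1) ^ (pathEdges γ).card *
        (dimerZ G.qEnds (dimerWeight (modifiedCoupling J (pathEdges γ) (pathEdges γd))) /
          dimerZ G.qEnds (dimerWeight fun e => (J e : ℂ))) := by
  have hJc : ∀ e, Complex.cosh (2 * (J e : ℂ)) ≠ 0 := fun e => cosh_two_mul_ofReal_ne_zero _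
  have hI := isingZ_ne_zero G.ends J
  have h1 := hG.isingZ_sq_eq_dimerZ (fun e => (J e : ℂ)) hJc
  have h2 := hG.isingZ_sq_eq_dimerZ (modifiedCoupling J (pathEdges γ) (pathEdges γd)) fun e => by
    rw [cosh_two_mul_modifiedCoupling]
    exact mul_ne_zero (by split_ifs <;> simp) (hJc e)
  -- The dimer sum is a factor of the nonzero square of the Ising sum.
  have hD : dimerZ G.qEnds (dimerWeight fun e => (J e : ℂ)) ≠ 0 := fun h => by
    rw [h, mul_zero] at h1
    exact pow_ne_zero 2 hI h1
  have hC : ∏ e, Complex.cosh (2 * (J e : ℂ)) ≠ 0 := Finset.prod_ne_zero_iff.mpr fun e _ => hJc e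
  refine ⟨hI, hD, ?_⟩
  rw [orderDisorderCorrelation, div_pow, h1, h2, prod_cosh_two_mul_modifiedCoupling]
  field_simp
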